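/- Let $k\ge 1$ and let $\{X_t\}_{t\in\mathbb Z}$ be a real-valued, mean-zero, $(k+1)$-th order stationary time series (that is, $E|X_t|^{k+1}<\infty$ and all joint moments of order at most $k+1$ are invariant under time shifts). Write $\gamma(h_1,\dots,h_n)=\mathrm{Cum}(X_t,X_{t+h_1},\dots,X_{t+h_n})$ for its autocumulants, $1\le n\le k$, and suppose that for every $2\le r\le k+1$ $$\sum_{v\in\mathbb Z^{r-1}}|v_j\,\gamma(v_1,\dots,v_{r-1})|<\infty,\qquad j=1,\dots,r-1 .$$ Let $f_k(\lambda)=\sum_{h\in\mathbb Z^k}\gamma(h)e^{-\iota h'\lambda}$ be the $k$-th order polyspectrum. Let $g:[-\pi,\pi]^k\to\mathbb C$ be bounded, continuous outside a set of Lebesgue measure zero, with $\int|g|<\infty$ and $g(\lambda)=\overline{g(-\lambda)}$ for all $\lambda$, and put $M_g(f_k)=\int_{[-\pi,\pi]^k}f_k(\lambda)g(\lambda)\,d\lambda$. For a sample $X_1,\dots,X_T$ let $d(\lambda)=\sum_{t=1}^T X_te^{-\iota\lambda t}$ and $\hat f_k(\lambda)=T^{-1}d(\lambda_1)\cdots d(\lambda_k)\,d(-\lambda_1-\cdots-\lambda_k)$,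 and define $$\widehat{M_g(f_k)}=(2\pi)^kT^{-k}\sum_{\tilde\lambda}\hat f_k(\tilde\lambda)\,g(\tilde\lambda)\,\Phi(\tilde\lambda),$$ where $\tilde\lambda$ runs over the vectors in $(-\pi,\pi]^k$ all of whose entries are Fourier frequencies $2\pi\ell/T$, $\ell\in\mathbb Z$, and $\Phi(\lambda)=1$ if no nonempty subfamily of $\lambda_1,\dots,\lambda_k$ has sum $\equiv 0 \pmod{2\pi}$, and $\Phi(\lambda)=0$ otherwise. Then, as $T\to\infty$, $$E\,\widehat{M_g(f_k)}=M_g(f_k)+o(1).$$ Moreover, with $g_T(\omega)=\sum_{\tilde\lambda}g(\tilde\lambda)\,\mathbf 1\big(\omega\in\tilde\lambda+(0,2\pi T^{-1}]^k\big)$ for $\omega\in(-\pi,\pi]^k$, the remainder is $O(T^{-1})$ provided that $\int_{(-\pi,\pi]^k}|g-g_T|=O(T^{-1})$. -/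

import Mathlib

open MeasureTheory Filter Asymptotics

noncomputable section

namespace Polyspectral

variable {Ω : Type*} [MeasurableSpace Ω]

/-- Stationarity of order `m`: moments of order `m` are finite and every joint moment
of order at most `m` is invariant under time shifts. -/
structure IsStationaryOfOrder (P : Measure Ω) (X : ℤ → Ω → ℝ) (m : ℕ) : Prop where
  memLp : ∀ t, MemLp (X t) m P
  moment_shift : ∀ r ≤ m, ∀ (t : Fin r → ℤ) (h : ℤ),
    ∫ ω, ∏ i, X (t i + h) ω ∂P = ∫ ω, ∏ i, X (t i) ω ∂P

/-- The joint cumulant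
`∑_π (-1)^(|π| - 1) (|π| - 1)! ∏_{b ∈ π} E ∏_{i ∈ b} Y i`, over all partitions `π` of the
index set. -/
def cumulant (P : Measure Ω) {n : ℕ} (Y : Fin n → Ω → ℝ) : ℝ :=
  ∑ π : Finpartition (Finset.univ : Finset (Fin n)),
    (-1 : ℝ) ^ (π.parts.card - 1) * ((π.parts.card - 1).factorial : ℝ) *
      ∏ b ∈ π.parts, ∫ ω, ∏ i ∈ b, Y i ω ∂P

/-- The autocumulant `γ(h₁, …, hₙ) = Cum(X_t, X_{t+h₁}, …, X_{t+hₙ})` of order `n + 1`, taken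
at `t = 0`; see `cumulant_shift_eq_autocumulant` for the independence of `t`. -/
def autocumulant (P : Measure Ω) (X : ℤ → Ω → ℝ) {n : ℕ} (h : Fin n → ℤ) : ℝ :=
  cumulant P (fun i => X ((Fin.cons 0 h : Fin (n + 1) → ℤ) i))

/-- Assumption A[r]: `∑_v |v_j γ(v₁, …, v_{r-1})| < ∞` for each `j`. -/
def AssumptionA (P : Measure Ω) (X : ℤ → Ω → ℝ) (r : ℕ) : Prop :=
  ∀ j : Fin (r - 1), Summable fun v : Fin (r - 1) → ℤ => |(v j : ℝ) * autocumulant P X v|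

/-- The polyspectrum `f_k(λ) = ∑_h γ(h) exp(-i h'λ)`. -/
def polyspectrum (P : Measure Ω) (X : ℤ → Ω → ℝ) (k : ℕ) (lam : Fin k → ℝ) : ℂ :=
  ∑' h : Fin k → ℤ,
    (autocumulant P X h : ℂ) * Complex.exp (-Complex.I * ((∑ j, (h j : ℝ) * lam j : ℝ) : ℂ))

/-- The cube `[-π, π]^k`. -/
def cube (k : ℕ) : Set (Fin k → ℝ) := Set.univ.pi fun _ => Set.Icc (-Real.pi) Real.pi

/-- The half-open cube `(-π, π]^k`. -/
def cubeIoc (k : ℕ) : Set (Fin k → ℝ) := Set.univ.pi fun _ => Set.Ioc (-Real.pi) Real.pi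

/-- The polyspectral mean `M_g(f_k) = ∫_{[-π, π]^k} f_k g`. -/
def polyMean (P : Measure Ω) (X : ℤ → Ω → ℝ) {k : ℕ} (g : (Fin k → ℝ) → ℂ) : ℂ :=
  ∫ lam in cube k, polyspectrum P X k lam * g lam

/-- The discrete Fourier transform `d(λ) = ∑_{t=1}^T X_t exp(-iλt)` of the sample. -/
def dft (X : ℤ → Ω → ℝ) (T : ℕ) (lam : ℝ) (ω : Ω) : ℂ :=
  ∑ t ∈ Finset.Icc 1 T, (X (t : ℤ) ω : ℂ) * Complex.exp (-Complex.I * ((lam * t : ℝ) : ℂ))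

/-- The periodogram of order `k`:
`T⁻¹ d(λ₁) ⋯ d(λ_k) d(-(λ₁ + ⋯ + λ_k))`. -/
def periodogram (X : ℤ → Ω → ℝ) (T : ℕ) {k : ℕ} (lam : Fin k → ℝ) (ω : Ω) : ℂ :=
  (T : ℂ)⁻¹ * (∏ j, dft X T (lam j) ω) * dft X T (-∑ j, lam j) ω

/-- The `ℓ ∈ {-⌊T/2⌋, …, ⌊T/2⌋}` for which `2πℓ/T` lies in `(-π, π]`. -/
def fourierIndices (T : ℕ) : Finset ℤ :=
  (Finset.Icc (-((T / 2 : ℕ) : ℤ)) ((T / 2 : ℕ) : ℤ)).filter fun l => -(T : ℤ) < 2 * l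

/-- The vector of Fourier frequencies `2πℓ_j/T`. -/
def fourierFreq (T : ℕ) {k : ℕ} (l : Fin k → ℤ) : Fin k → ℝ :=
  fun j => 2 * Real.pi * (l j : ℝ) / (T : ℝ)

/-- The indices of all `k`-vectors of Fourier frequencies. -/
def fourierGrid (T k : ℕ) : Finset (Fin k → ℤ) :=
  Fintype.piFinset fun _ => fourierIndices T

/-- No nonempty subset of the frequencies sums to `0` modulo `2π`. -/
def OffSubmanifolds {k : ℕ} (lam : Fin k → ℝ) : Prop :=
  ∀ s : Finset (Fin k), s.Nonempty → ∀ m : ℤ, ∑ j ∈ s, lam j ≠ 2 * Real.pi * (m : ℝ)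

open Classical in
/-- The indicator `Φ`. -/
def Phi {k : ℕ} (lam : Fin k → ℝ) : ℂ := if OffSubmanifolds lam then 1 else 0

/-- The estimator of `M_g(f_k)`:
`(2π)^k T^{-k} ∑ f̂_k(λ) g(λ) Φ(λ)` over the Fourier frequencies. -/
def polyMeanEstimator (X : ℤ → Ω → ℝ) {k : ℕ} (g : (Fin k → ℝ) → ℂ) (T : ℕ) (ω : Ω) : ℂ :=
  (2 * (Real.pi : ℂ)) ^ k * ((T : ℂ) ^ k)⁻¹ *
    ∑ l ∈ fourierGrid T k,
      periodogram X T (fourierFreq T l) ω * g (fourierFreq T l) * Phi (fourierFreq T l)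

/-- The discretization `g_T(ω) = ∑ g(λ) 1(ω ∈ λ + (0, 2π/T]^k)` over the Fourier
frequencies. -/
def discretization {k : ℕ} (g : (Fin k → ℝ) → ℂ) (T : ℕ) (w : Fin k → ℝ) : ℂ :=
  ∑ l ∈ fourierGrid T k,
    Set.indicator
      (Set.univ.pi fun j => Set.Ioc (fourierFreq T l j) (fourierFreq T l j + 2 * Real.pi / T))
      (fun _ => g (fourierFreq T l)) w

/-- Under stationarity of order `n + 1` the autocumulant does not depend on the base time. -/
theorem cumulant_shift_eq_autocumulant {P : Measure Ω} {X : ℤ → Ω → ℝ} {n : ℕ}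
    (hX : IsStationaryOfOrder P X (n + 1)) (h : Fin n → ℤ) (t : ℤ) :
    cumulant P (fun i => X (t + (Fin.cons 0 h : Fin (n + 1) → ℤ) i)) = autocumulant P X h := by
  unfold autocumulant cumulant
  refine Finset.sum_congr rfl fun π _ => ?_
  congr 1
  refine Finset.prod_congr rfl fun b _ => ?_
  have hb : b.card ≤ n + 1 := by simpa using Finset.card_le_univ b
  have key := hX.moment_shift b.card hb
    (fun i => (Fin.cons 0 h : Fin (n + 1) → ℤ) (b.equivFin.symm i)) t
  have e : ∀ F : Fin (n + 1) → ℝ,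
      ∏ i : Fin b.card, F (b.equivFin.symm i) = ∏ i ∈ b, F i := fun F => by
    rw [Equiv.prod_comp b.equivFin.symm (fun x : b => F x), Finset.prod_coe_sort]
  have e1 := fun ω => e (fun i => X (t + (Fin.cons 0 h : Fin (n + 1) → ℤ) i) ω)
  have e2 := fun ω => e (fun i => X ((Fin.cons 0 h : Fin (n + 1) → ℤ) i) ω)
  simp only [← e1, ← e2]
  simpa only [add_comm t] using key

end Polyspectral

end

/-! The expected periodogram is `T⁻¹` times a joint moment of `k + 1` discrete Fourier transforms
whose frequencies sum to zero. By stationarity, the joint cumulant of DFTs equals the Dirichlet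
kernel at the total frequency times a polyspectrum, up to the effect of lags that leave the window
`[1, T]`. A lag vector `v` does so for at most `∑ |v_j|` base times, so the weighted summability of
the autocumulants makes this error bounded in `T` and in the frequencies
(`norm_sum_cumulant_sub_le`).

At total frequency zero the kernel is `T`; at a Fourier frequency that is nonzero modulo `2π` it
vanishes. Off the submanifolds every proper subfamily of the `k + 1` frequencies has such a nonzero
sum, so cumulants over proper blocks are bounded. Moments over proper blocks are then bounded as
well, by induction on the order (`exists_norm_integral_prod_dft_le`): a moment differs from its
cumulant only by products of lower moments. Hence the full moment is `T f_k + O(1)`, and the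
periodogram has bias `O(1/T)` uniformly (`exists_norm_integral_periodogram_sub_le`).

Only `O(T^(k-1))` grid points lie on the submanifolds, so `Φ` costs `O(1/T)`. There remains a
Riemann sum of `f_k g`. Since `f_k` is bounded and Lipschitz, its error is a multiple of the `L¹`
distance from `g` to `g_T`, plus `O(1/T)` (`norm_riemannSum_mul_sub_le`). That distance tends to
zero by dominated convergence. -/

namespace Polyspectral

/-! ### Moments of products of discrete Fourier transforms. -/

section Moments

variable {Ω : Type*} [MeasurableSpace Ω] {P : Measure Ω} {X : ℤ → Ω → ℝ}

/-- Stationarity of some order implies stationarity of any lower order. -/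
lemma IsStationaryOfOrder.mono [IsFiniteMeasure P] {m n : ℕ} (hX : IsStationaryOfOrder P X m)
    (h : n ≤ m) : IsStationaryOfOrder P X n :=
  ⟨fun t => (hX.memLp t).mono_exponent (by exact_mod_cast h),
    fun r hr => hX.moment_shift r (hr.trans h)⟩

/-- Hölder's inequality: at most `m` factors in `L^m` have an integrable product on a finite measure
space. -/
lemma IsStationaryOfOrder.integrable_prod [IsFiniteMeasure P] {m : ℕ}
    (hX : IsStationaryOfOrder P X m) {ι : Type*} [Fintype ι] (hι : Fintype.card ι ≤ m)
    (t : ι → ℤ) : Integrable (fun ω => ∏ i, X (t i) ω) P := by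
  have h := MemLp.prod' (s := Finset.univ) (p := fun _ : ι => (m : ENNReal))
    (f := fun i => X (t i)) (μ := P) fun i _ => hX.memLp (t i)
  refine memLp_one_iff_integrable.1 (h.mono_exponent ?_)
  rw [ENNReal.one_le_inv]
  simp only [Finset.sum_const, Finset.card_univ, nsmul_eq_mul]
  rw [← div_eq_mul_inv]
  refine ENNReal.div_le_of_le_mul ?_
  rw [one_mul]
  exact_mod_cast hι

/-- The exponential `exp(-iλt)`. -/
noncomputable def expNeg (lam : ℝ) (t : ℝ) : ℂ := Complex.exp (-Complex.I * ((lam * t : ℝ) : ℂ))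

lemma norm_expNeg (lam t : ℝ) : ‖expNeg lam t‖ = 1 := by
  rw [expNeg, show -Complex.I * ((lam * t : ℝ) : ℂ) = ((-(lam * t) : ℝ) : ℂ) * Complex.I by
    push_cast; ring]
  exact Complex.norm_exp_ofReal_mul_I _

/-- The product of discrete Fourier transforms as a sum over time vectors. -/
lemma prod_dft_eq {Ω ι : Type*} [Fintype ι] [DecidableEq ι] (X : ℤ → Ω → ℝ) (T : ℕ)
    (lam : ι → ℝ) (ω : Ω) :
    ∏ i, dft X T (lam i) ω =
      ∑ t ∈ Fintype.piFinset (fun _ : ι => Finset.Icc 1 T),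
        ((∏ i, X (t i) ω : ℝ) : ℂ) * ∏ i, expNeg (lam i) (t i) := by
  simp only [dft, Finset.prod_univ_sum, Finset.prod_mul_distrib, expNeg, Complex.ofReal_prod]

lemma integrable_prod_dft [IsFiniteMeasure P] {m : ℕ} (hX : IsStationaryOfOrder P X m)
    {ι : Type*} [Fintype ι] (hι : Fintype.card ι ≤ m) (T : ℕ) (lam : ι → ℝ) :
    Integrable (fun ω => ∏ i, dft X T (lam i) ω) P := by
  classical
  simp only [prod_dft_eq]
  exact integrable_finsetSum _ fun t _ => ((hX.integrable_prod hι _).ofReal).mul_const _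

/-- The expectation of a product of discrete Fourier transforms. -/
lemma integral_prod_dft [IsFiniteMeasure P] {m : ℕ} (hX : IsStationaryOfOrder P X m)
    {ι : Type*} [Fintype ι] [DecidableEq ι] (hι : Fintype.card ι ≤ m) (T : ℕ) (lam : ι → ℝ) :
    ∫ ω, ∏ i, dft X T (lam i) ω ∂P =
      ∑ t ∈ Fintype.piFinset (fun _ : ι => Finset.Icc 1 T),
        ((∫ ω, ∏ i, X (t i) ω ∂P : ℝ) : ℂ) * ∏ i, expNeg (lam i) (t i) := by
  simp only [prod_dft_eq]
  rw [integral_finsetSum _ fun t _ => ((hX.integrable_prod hι _).ofReal).mul_const _]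
  refine Finset.sum_congr rfl fun t _ => ?_
  rw [integral_mul_const, integral_complex_ofReal]

end Moments

/-! ### Set partitions and the moment-cumulant formula. -/

section Partitions

/-- A product over the blocks of a partition of sums over vectors indexed by the blocks is a sum
over vectors indexed by the whole set. -/
lemma prod_parts_sum {ι κ R : Type*} [Fintype ι] [DecidableEq ι] [CommSemiring R]
    (π : Finpartition (Finset.univ : Finset ι)) (A : Finset κ)
    (G : (b : Finset ι) → (b → κ) → R) :
    ∏ b ∈ π.parts, ∑ t ∈ Fintype.piFinset (fun _ : b => A), G b t =
      ∑ t ∈ Fintype.piFinset (fun _ : ι => A), ∏ b ∈ π.parts, G b (fun i => t i) := by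
  classical
  rw [← Finset.prod_coe_sort, Finset.prod_univ_sum]
  -- Gluing reads coordinate `i` in the unique block containing `i`; it is inverse to restricting a
  -- vector to the blocks.
  refine Finset.sum_bij' (fun p _ i => p ⟨π.part i, π.part_mem.2 (Finset.mem_univ i)⟩
      ⟨i, π.mem_part (Finset.mem_univ i)⟩) (fun t _ b i => t i) ?_ ?_ ?_ ?_ ?_
  · intro p hp
    simp only [Fintype.mem_piFinset] at hp ⊢
    exact fun i => hp _ _
  · intro t ht
    simp only [Fintype.mem_piFinset] at ht ⊢
    exact fun b i => ht i
  · intro p _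
    funext b i
    have h : π.part i = b.1 := π.part_eq_of_mem b.2 i.2
    obtain ⟨b, hb⟩ := b
    obtain ⟨i, hi⟩ := i
    simp only at h
    subst h
    rfl
  · intro t _
    rfl
  · intro p _
    refine Eq.trans ?_ (Finset.prod_coe_sort π.parts _)
    refine Finset.prod_congr rfl fun b _ => ?_
    congr 1
    funext i
    have h : π.part i = b.1 := π.part_eq_of_mem b.2 i.2
    obtain ⟨b, hb⟩ := b
    obtain ⟨i, hi⟩ := i
    simp only at h
    subst h
    rfl

/-- The coefficient of a partition in the expression of cumulants through moments. -/
noncomputable def cumCoeff {n : ℕ} (π : Finpartition (Finset.univ : Finset (Fin n))) : ℝ :=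
  (-1 : ℝ) ^ (π.parts.card - 1) * ((π.parts.card - 1).factorial : ℝ)

/-- The cumulant attached to a family of moments of subsets of the index set. -/
noncomputable def cumOfMoments {n : ℕ} (M : Finset (Fin n) → ℂ) : ℂ :=
  ∑ π : Finpartition (Finset.univ : Finset (Fin n)), (cumCoeff π : ℂ) * ∏ b ∈ π.parts, M b

/-- The top moment differs from the cumulant by a quantity controlled by the lower moments. -/
lemma exists_norm_moment_sub_le {n : ℕ} (hn : 1 ≤ n) (C : ℝ) :
    ∃ K : ℝ, 0 ≤ K ∧ ∀ M : Finset (Fin n) → ℂ,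
      (∀ b : Finset (Fin n), b.Nonempty → b ≠ Finset.univ → ‖M b‖ ≤ C) →
      ‖M Finset.univ - cumOfMoments M‖ ≤ K := by
  classical
  have hne : (Finset.univ : Finset (Fin n)) ≠ ⊥ := by
    have : Nonempty (Fin n) := ⟨⟨0, hn⟩⟩
    exact Finset.univ_nonempty.ne_empty
  set π₀ := Finpartition.indiscrete hne with hπ₀
  -- The one-block partition contributes exactly the top moment, with coefficient 1. In every other
  -- partition all blocks are proper, so each factor is at most `C ≤ |C|`.
  refine ⟨∑ π ∈ Finset.univ.erase π₀, |cumCoeff π| * |C| ^ π.parts.card, by positivity,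
    fun M hM => ?_⟩
  have h0 : (cumCoeff π₀ : ℂ) * ∏ b ∈ π₀.parts, M b = M Finset.univ := by
    simp [cumCoeff, hπ₀]
  rw [cumOfMoments, ← Finset.add_sum_erase _ _ (Finset.mem_univ π₀), h0, sub_add_cancel_left,
    norm_neg]
  refine norm_sum_le_of_le _ fun π hπ => ?_
  rw [norm_mul, norm_prod, Complex.norm_real, Real.norm_eq_abs, ← Finset.prod_const]
  gcongr with b hb
  have hbne : b ≠ Finset.univ := by
    rintro rfl
    refine Finset.ne_of_mem_erase hπ (Finpartition.ext ?_)
    rw [hπ₀, Finpartition.indiscrete_parts]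
    refine Finset.eq_singleton_iff_unique_mem.2 ⟨hb, fun c hc => ?_⟩
    by_contra hcb
    have := π.disjoint hc hb hcb
    exact π.ne_bot hc (this.eq_bot_of_le (Finset.subset_univ c))
  exact (hM b (Finset.nonempty_iff_ne_empty.2 (π.ne_bot hb)) hbne).trans (le_abs_self C)

end Partitions

/-! ### Multilinearity of the cumulant. -/

section DftCumulant

variable {Ω : Type*} [MeasurableSpace Ω] {P : Measure Ω} {X : ℤ → Ω → ℝ}

/-- Multilinearity: the joint cumulant of discrete Fourier transforms. -/
lemma cumOfMoments_dft [IsFiniteMeasure P] {n m : ℕ} (hX : IsStationaryOfOrder P X m)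
    (hn : n ≤ m) (T : ℕ) (lam : Fin n → ℝ) :
    cumOfMoments (fun b => ∫ ω, ∏ i ∈ b, dft X T (lam i) ω ∂P) =
      ∑ t ∈ Fintype.piFinset (fun _ : Fin n => Finset.Icc 1 T),
        (cumulant P (fun i => X (t i)) : ℂ) * ∏ i, expNeg (lam i) (t i) := by
  classical
  have hb : ∀ b : Finset (Fin n), ∫ ω, ∏ i ∈ b, dft X T (lam i) ω ∂P =
      ∑ t ∈ Fintype.piFinset (fun _ : b => Finset.Icc 1 T),
        ((∫ ω, ∏ i : b, X (t i) ω ∂P : ℝ) : ℂ) * ∏ i : b, expNeg (lam i) (t i) := by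
    intro b
    rw [← integral_prod_dft hX ((by simpa using Finset.card_le_univ b :
      Fintype.card b ≤ n).trans hn) T (fun i : b => lam i)]
    refine integral_congr_ae (.of_forall fun ω => ?_)
    exact (Finset.prod_coe_sort b fun i => dft X T (lam i) ω).symm
  simp only [cumOfMoments, hb, cumulant, Complex.ofReal_sum, Finset.sum_mul]
  rw [Finset.sum_comm]
  refine Finset.sum_congr rfl fun π _ => ?_
  rw [prod_parts_sum π (Finset.Icc 1 T) (fun b t => ((∫ ω, ∏ i : b, X (t i) ω ∂P : ℝ) : ℂ) *
    ∏ i : b, expNeg (lam i) (t i)), Finset.mul_sum]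
  refine Finset.sum_congr rfl fun t _ => ?_
  have h1 : ∏ b ∈ π.parts, ∏ i : b, expNeg (lam i) (t i) = ∏ i, expNeg (lam i) (t i) := by
    rw [← Finset.prod_congr π.biUnion_parts fun _ _ => rfl,
      Finset.prod_biUnion π.supIndep.pairwiseDisjoint]
    exact Finset.prod_congr rfl fun b _ =>
      Finset.prod_coe_sort b fun i => expNeg (lam i) (t i)
  have h2 : ∀ b : Finset (Fin n), ∫ ω, ∏ i : b, X (t i) ω ∂P = ∫ ω, ∏ i ∈ b, X (t i) ω ∂P :=
    fun b => integral_congr_ae (.of_forall fun ω =>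
      Finset.prod_coe_sort b fun i => X (t i) ω)
  rw [Finset.prod_mul_distrib, h1]
  simp only [h2, cumCoeff]
  push_cast
  ring

end DftCumulant

/-! ### Cumulants of the Fourier transforms and the polyspectrum. -/

section CumulantSums

variable {Ω : Type*} [MeasurableSpace Ω] {P : Measure Ω} {X : ℤ → Ω → ℝ}

lemma AssumptionA.summable_mul_sum {m : ℕ} (hA : AssumptionA P X (m + 1)) :
    Summable fun v : Fin m → ℤ => |autocumulant P X v| * ∑ j, |(v j : ℝ)| := by
  have h := summable_sum (s := Finset.univ) fun j _ => hA j
  refine h.congr fun v => ?_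
  rw [Finset.mul_sum]
  refine Finset.sum_congr rfl fun j _ => ?_
  rw [abs_mul, mul_comm]

/-- Away from the origin some integer `|v j|` is at least 1, so the weighted series dominates; the
origin is a single term. -/
lemma AssumptionA.summable_abs {m : ℕ} (hA : AssumptionA P X (m + 1)) :
    Summable fun v : Fin m → ℤ => |autocumulant P X v| := by
  classical
  have h0 : Summable fun v : Fin m → ℤ => if v = 0 then |autocumulant P X v| else 0 :=
    summable_of_hasFiniteSupport ((Set.finite_singleton (0 : Fin m → ℤ)).subset fun v hv => by
      by_contra hne
      exact hv (if_neg hne))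
  refine (h0.add hA.summable_mul_sum).of_nonneg_of_le (fun v => abs_nonneg _) fun v => ?_
  by_cases hv : v = 0
  · rw [if_pos hv]
    have : 0 ≤ |autocumulant P X v| * ∑ j, |(v j : ℝ)| := by positivity
    linarith
  · rw [if_neg hv, zero_add]
    obtain ⟨j, hj⟩ := Function.ne_iff.1 hv
    refine le_mul_of_one_le_right (abs_nonneg _) ?_
    have h1 : (1 : ℝ) ≤ |(v j : ℝ)| := by
      exact_mod_cast Int.one_le_abs hj
    exact h1.trans (Finset.single_le_sum (f := fun j => |(v j : ℝ)|)
      (fun _ _ => abs_nonneg _) (Finset.mem_univ j))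

/-- The general term of the Fourier series of the polyspectrum. -/
noncomputable def polyTerm (P : Measure Ω) (X : ℤ → Ω → ℝ) {m : ℕ} (lam : Fin m → ℝ)
    (h : Fin m → ℤ) : ℂ :=
  (autocumulant P X h : ℂ) * Complex.exp (-Complex.I * ((∑ j, (h j : ℝ) * lam j : ℝ) : ℂ))

lemma norm_polyTerm {m : ℕ} (lam : Fin m → ℝ) (h : Fin m → ℤ) :
    ‖polyTerm P X lam h‖ = |autocumulant P X h| := by
  have := norm_expNeg (∑ j, (h j : ℝ) * lam j) 1
  rw [expNeg, mul_one] at this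
  rw [polyTerm, norm_mul, this, mul_one, Complex.norm_real, Real.norm_eq_abs]

lemma AssumptionA.summable_polyTerm {m : ℕ} (hA : AssumptionA P X (m + 1)) (lam : Fin m → ℝ) :
    Summable (polyTerm P X lam) :=
  Summable.of_norm (hA.summable_abs.congr fun h => (norm_polyTerm lam h).symm)

/-- The number of times in `[1, T]` moved out of `[1, T]` by the shift `v` is at most `|v|`. -/
lemma card_filter_shift_le (T : ℕ) (v : ℤ) :
    ((Finset.Icc 1 T).filter fun s : ℕ => v + s ∉ Finset.Icc (1 : ℤ) T).card ≤ v.natAbs := by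
  rcases le_total 0 v with hv | hv
  · calc _ ≤ (Finset.Ioc (T - v.natAbs) T).card := Finset.card_le_card fun s hs => by
          simp only [Finset.mem_filter, Finset.mem_Icc, Finset.mem_Ioc] at hs ⊢
          omega
      _ ≤ _ := by rw [Nat.card_Ioc]; omega
  · calc _ ≤ (Finset.Icc 1 v.natAbs).card := Finset.card_le_card fun s hs => by
          simp only [Finset.mem_filter, Finset.mem_Icc] at hs ⊢
          omega
      _ ≤ _ := by simp

lemma sum_piFinset_cons {M : Type*} [AddCommMonoid M] {m : ℕ} {κ : Type*} (A : Finset κ)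
    (F : (Fin (m + 1) → κ) → M) :
    ∑ t ∈ Fintype.piFinset (fun _ : Fin (m + 1) => A), F t =
      ∑ s ∈ A, ∑ u ∈ Fintype.piFinset (fun _ : Fin m => A), F (Fin.cons s u) := by
  rw [← Finset.sum_product']
  refine Finset.sum_bij' (fun t _ => (t 0, Fin.tail t)) (fun p _ => Fin.cons p.1 p.2) ?_ ?_ ?_ ?_ ?_
  · intro t ht
    simp only [Fintype.mem_piFinset, Finset.mem_product] at ht ⊢
    exact ⟨ht 0, fun j => ht j.succ⟩
  · rintro ⟨s, u⟩ hp
    simp only [Fintype.mem_piFinset, Finset.mem_product] at hp ⊢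
    exact Fin.cases hp.1 hp.2
  · intro t _
    exact Fin.cons_self_tail t
  · rintro ⟨s, u⟩ _
    simp
  · intro t _
    simp

/-- By stationarity the cumulant depends only on the lags `u - s`. Writing each time as `s` plus its
lag splits the phase into a factor at the total frequency, which will sum to the Dirichlet kernel,
and the phase of a polyspectral term. -/
lemma cumulant_mul_prod_expNeg {m : ℕ} (hX : IsStationaryOfOrder P X (m + 1))
    (lam : Fin (m + 1) → ℝ) (s : ℕ) (u : Fin m → ℕ) :
    (cumulant P (fun i => X (((Fin.cons s u : Fin (m + 1) → ℕ) i : ℕ) : ℤ)) : ℂ) *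
        ∏ i, expNeg (lam i) (((Fin.cons s u : Fin (m + 1) → ℕ) i : ℕ) : ℝ) =
      expNeg (∑ i, lam i) s *
        polyTerm P X (fun j => lam j.succ) (fun j => (u j : ℤ) - (s : ℤ)) := by
  have h1 : cumulant P (fun i => X (((Fin.cons s u : Fin (m + 1) → ℕ) i : ℕ) : ℤ)) =
      autocumulant P X (fun j => (u j : ℤ) - (s : ℤ)) := by
    rw [← cumulant_shift_eq_autocumulant hX (fun j => (u j : ℤ) - (s : ℤ)) s]
    congr 1
    funext i
    congr 1
    refine Fin.cases ?_ (fun j => ?_) i <;> simp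
  rw [h1, polyTerm, mul_left_comm]
  congr 1
  simp only [expNeg]
  rw [← Complex.exp_sum, ← Complex.exp_add, ← Finset.mul_sum, ← mul_add]
  congr 2
  rw [Fin.sum_univ_succ]
  norm_cast
  simp only [Fin.cons_zero, Fin.cons_succ, Fin.sum_univ_succ (fun i => lam i)]
  push_cast
  simp only [sub_mul, Finset.sum_sub_distrib, add_mul, Finset.sum_mul]
  have : ∑ j, (s : ℝ) * lam (Fin.succ j) = ∑ j, lam (Fin.succ j) * (s : ℝ) :=
    Finset.sum_congr rfl fun _ _ => mul_comm _ _
  have h3 : ∑ j, (u j : ℝ) * lam (Fin.succ j) = ∑ j, lam (Fin.succ j) * (u j : ℝ) :=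
    Finset.sum_congr rfl fun _ _ => mul_comm _ _
  rw [this, h3]
  ring

/-- The substitution `v = u - s` gives a truncated series over all lags, to be compared term by term
with the full polyspectrum. -/
lemma sum_box_eq_tsum {m : ℕ} (a : (Fin m → ℤ) → ℂ) (T s : ℕ) :
    ∑ u ∈ Fintype.piFinset (fun _ : Fin m => Finset.Icc 1 T), a (fun j => (u j : ℤ) - (s : ℤ)) =
      ∑' v : Fin m → ℤ, if ∀ j, v j + s ∈ Finset.Icc (1 : ℤ) T then a v else 0 := by
  classical
  rw [tsum_eq_sum (s := Fintype.piFinset fun _ : Fin m => Finset.Icc (1 - s : ℤ) (T - s))]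
  · refine Finset.sum_bij' (fun u _ j => (u j : ℤ) - (s : ℤ)) (fun v _ j => (v j + s).toNat)
      ?_ ?_ ?_ ?_ ?_
    · intro u hu
      simp only [Fintype.mem_piFinset, Finset.mem_Icc] at hu ⊢
      intro j
      have := hu j
      omega
    · intro v hv
      simp only [Fintype.mem_piFinset, Finset.mem_Icc] at hv ⊢
      intro j
      have := hv j
      omega
    · intro u _
      funext j
      simp
    · intro v hv
      simp only [Fintype.mem_piFinset, Finset.mem_Icc] at hv
      funext j
      have := hv j
      dsimp only
      omega
    · intro u hu
      simp only [Fintype.mem_piFinset, Finset.mem_Icc] at hu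
      rw [if_pos]
      intro j
      have := hu j
      simp only [Finset.mem_Icc]
      omega
  · intro v hv
    rw [if_neg]
    intro h
    refine hv ?_
    simp only [Fintype.mem_piFinset, Finset.mem_Icc] at h ⊢
    intro j
    have := h j
    omega

/-- The joint cumulant of discrete Fourier transforms is, up to a bounded error, the polyspectrum
times the Dirichlet kernel at the sum of all the frequencies. -/
lemma norm_sum_cumulant_sub_le {m : ℕ} (hX : IsStationaryOfOrder P X (m + 1))
    (hA : AssumptionA P X (m + 1)) (T : ℕ) (lam : Fin (m + 1) → ℝ) :
    ‖∑ t ∈ Fintype.piFinset (fun _ : Fin (m + 1) => Finset.Icc 1 T),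
        (cumulant P (fun i => X (t i)) : ℂ) * ∏ i, expNeg (lam i) (t i) -
      (∑ s ∈ Finset.Icc 1 T, expNeg (∑ i, lam i) s) *
        polyspectrum P X m (fun j => lam j.succ)‖ ≤
      ∑' v : Fin m → ℤ, |autocumulant P X v| * ∑ j, |(v j : ℝ)| := by
  classical
  set a := polyTerm P X (fun j => lam j.succ) with ha
  have hsum : Summable a := hA.summable_polyTerm _
  have hite : ∀ s : ℕ, Summable fun v : Fin m → ℤ =>
      if ∀ j, v j + s ∈ Finset.Icc (1 : ℤ) T then a v else 0 := fun s =>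
    hsum.indicator {v : Fin m → ℤ | ∀ j, v j + s ∈ Finset.Icc (1 : ℤ) T} |>.congr fun v => by
      simp [Set.indicator_apply]
  have hout : ∀ s : ℕ, Summable fun v : Fin m → ℤ =>
      if ∀ j, v j + s ∈ Finset.Icc (1 : ℤ) T then 0 else |autocumulant P X v| := fun s =>
    hA.summable_abs.of_nonneg_of_le (fun v => by split_ifs <;> positivity)
      (fun v => by split_ifs <;> simp)
  rw [sum_piFinset_cons, Finset.sum_mul, ← Finset.sum_sub_distrib]
  calc _ ≤ ∑ s ∈ Finset.Icc 1 T, ∑' v : Fin m → ℤ,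
        (if ∀ j, v j + s ∈ Finset.Icc (1 : ℤ) T then 0 else |autocumulant P X v|) := by
        refine norm_sum_le_of_le _ fun s _ => ?_
        simp only [cumulant_mul_prod_expNeg hX]
        rw [← Finset.mul_sum, sum_box_eq_tsum, ← mul_sub, norm_mul, norm_expNeg, one_mul]
        rw [show polyspectrum P X m (fun j => lam j.succ) = ∑' v, a v from rfl,
          ← (hite s).tsum_sub hsum]
        refine tsum_of_norm_bounded (hout s).hasSum fun v => ?_
        split_ifs
        · simp
        · rw [zero_sub, norm_neg, ha, norm_polyTerm]
    -- Exchanging the sums lets the bad base times be counted for a fixed lag vector, by a union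
    -- bound over its coordinates.
    _ = ∑' v : Fin m → ℤ, ∑ s ∈ Finset.Icc 1 T,
        (if ∀ j, v j + s ∈ Finset.Icc (1 : ℤ) T then 0 else |autocumulant P X v|) :=
        (Summable.tsum_finsetSum fun s _ => hout s).symm
    _ ≤ _ := by
        refine Summable.tsum_le_tsum (fun v => ?_) (summable_sum fun s _ => hout s)
          hA.summable_mul_sum
        calc _ ≤ ∑ s ∈ Finset.Icc 1 T, ∑ j,
              (if v j + s ∉ Finset.Icc (1 : ℤ) T then |autocumulant P X v| else 0) := by
              refine Finset.sum_le_sum fun s _ => ?_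
              have hnn : ∀ j ∈ Finset.univ, 0 ≤
                  (if v j + s ∉ Finset.Icc (1 : ℤ) T then |autocumulant P X v| else 0) :=
                fun j _ => by split_ifs <;> positivity
              split_ifs with h
              · exact Finset.sum_nonneg hnn
              · obtain ⟨j, hj⟩ := not_forall.1 h
                refine le_trans ?_ (Finset.single_le_sum hnn (Finset.mem_univ j))
                rw [if_pos hj]
          _ ≤ _ := by
              rw [Finset.sum_comm, Finset.mul_sum]
              refine Finset.sum_le_sum fun j _ => ?_
              rw [← Finset.sum_filter, Finset.sum_const, nsmul_eq_mul, mul_comm]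
              refine mul_le_mul_of_nonneg_left ?_ (abs_nonneg _)
              rw [← Int.cast_abs, Int.abs_eq_natAbs]
              exact_mod_cast card_filter_shift_le T (v j)

end CumulantSums

/-! ### Bias of the periodogram off the submanifolds. -/

section Expectation

variable {Ω : Type*} [MeasurableSpace Ω] {P : Measure Ω} {X : ℤ → Ω → ℝ}

lemma expNeg_natCast (lam : ℝ) (t : ℕ) : expNeg lam t = expNeg lam 1 ^ t := by
  rw [expNeg, expNeg, ← Complex.exp_nat_mul]
  congr 1
  push_cast
  ring

lemma sum_expNeg_zero (T : ℕ) : ∑ t ∈ Finset.Icc 1 T, expNeg 0 t = T := by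
  simp [expNeg]

/-- The Dirichlet kernel vanishes at the nonzero Fourier frequencies. -/
lemma sum_expNeg_fourier {T : ℕ} (hT : 1 ≤ T) {l : ℤ} (hl : ¬ (T : ℤ) ∣ l) :
    ∑ t ∈ Finset.Icc 1 T, expNeg (2 * Real.pi * l / T) t = 0 := by
  have hT0 : (T : ℂ) ≠ 0 := by exact_mod_cast (by omega : T ≠ 0)
  have hpi : (2 * Real.pi * Complex.I : ℂ) ≠ 0 := Complex.two_pi_I_ne_zero
  -- The kernel is a geometric sum of a nontrivial `T`-th root of unity.
  set z := expNeg (2 * Real.pi * l / T) 1 with hz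
  have hzT : z ^ T = 1 := by
    rw [hz, expNeg, ← Complex.exp_nat_mul, Complex.exp_eq_one_iff]
    refine ⟨-l, ?_⟩
    push_cast
    field_simp
  have hz1 : z ≠ 1 := by
    rw [hz, expNeg, Ne, Complex.exp_eq_one_iff]
    rintro ⟨n, hn⟩
    refine hl ⟨-n, ?_⟩
    have h1 : (2 * Real.pi * Complex.I : ℂ) * (l : ℂ) =
        (2 * Real.pi * Complex.I) * ((T : ℂ) * (-n : ℂ)) := by
      push_cast at hn
      field_simp at hn ⊢
      linear_combination -hn
    have h2 := mul_left_cancel₀ hpi h1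
    exact_mod_cast h2
  simp only [expNeg_natCast, ← hz]
  rw [show Finset.Icc 1 T = Finset.Ico 1 (T + 1) from rfl, geom_sum_Ico hz1 (by omega), pow_succ,
    hzT, one_mul, pow_one, sub_self, zero_div]

/-- The expected product over a block, indexed by an initial segment of the naturals. -/
lemma integral_prod_dft_finset {n T : ℕ} (lam : Fin n → ℝ) (b : Finset (Fin n)) :
    ∫ ω, ∏ i ∈ b, dft X T (lam i) ω ∂P =
      ∫ ω, ∏ i : Fin b.card, dft X T (lam (b.equivFin.symm i)) ω ∂P := by
  refine integral_congr_ae (.of_forall fun ω => ?_)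
  dsimp only
  rw [Equiv.prod_comp b.equivFin.symm (fun x : b => dft X T (lam x) ω),
    Finset.prod_coe_sort b fun i => dft X T (lam i) ω]

lemma fourierFreq_sum (T : ℕ) {k : ℕ} (l : Fin k → ℤ) (s : Finset (Fin k)) :
    ∑ i ∈ s, fourierFreq T l i = 2 * Real.pi * ((∑ i ∈ s, l i : ℤ) : ℝ) / T := by
  simp only [fourierFreq]
  push_cast
  rw [Finset.mul_sum, Finset.sum_div]

lemma offSubmanifolds_fourierFreq_iff {T k : ℕ} (hT : 1 ≤ T) (l : Fin k → ℤ) :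
    OffSubmanifolds (fourierFreq T l) ↔
      ∀ s : Finset (Fin k), s.Nonempty → ¬ (T : ℤ) ∣ ∑ i ∈ s, l i := by
  have hT0 : (T : ℝ) ≠ 0 := by exact_mod_cast (by omega : T ≠ 0)
  refine forall₂_congr fun s _ => ?_
  rw [dvd_def, not_exists]
  refine forall_congr' fun m => not_congr ?_
  rw [fourierFreq_sum, div_eq_iff hT0, mul_assoc (2 * Real.pi),
    mul_right_inj' Real.two_pi_pos.ne', mul_comm (m : ℝ)]
  exact_mod_cast Iff.rfl

lemma offSubmanifolds_block {n : ℕ} {lam : Fin n → ℝ} (b : Finset (Fin n))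
    (h : ∀ s ⊆ b, s.Nonempty → ∀ m : ℤ, ∑ j ∈ s, lam j ≠ 2 * Real.pi * (m : ℝ)) :
    OffSubmanifolds fun i : Fin b.card => lam (b.equivFin.symm i) := by
  intro s hs m
  let e : Fin b.card ↪ Fin n :=
    b.equivFin.symm.toEmbedding.trans (Function.Embedding.subtype (· ∈ b))
  have := h (s.map e) (fun x hx => by
    obtain ⟨i, _, rfl⟩ := Finset.mem_map.1 hx
    exact (b.equivFin.symm i).2) (hs.map) m
  rwa [Finset.sum_map] at this

lemma card_lt_of_ne_univ {n : ℕ} {b : Finset (Fin n)} (hb : b ≠ Finset.univ) : b.card < n := by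
  simpa using (Finset.card_lt_iff_ne_univ b).2 hb

/-- Below the order of stationarity, the expected product of discrete Fourier transforms is bounded
uniformly over the Fourier frequencies off the submanifolds. -/
lemma exists_norm_integral_prod_dft_le [IsProbabilityMeasure P] {k : ℕ}
    (hX : IsStationaryOfOrder P X (k + 1))
    (hA : ∀ r, 2 ≤ r → r ≤ k + 1 → AssumptionA P X r) (n : ℕ) (hn : n ≤ k + 1) :
    ∃ C : ℝ, 0 ≤ C ∧ ∀ m ≤ n, 1 ≤ m → ∀ T : ℕ, 1 ≤ T → ∀ l : Fin m → ℤ,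
      OffSubmanifolds (fourierFreq T l) →
      ‖∫ ω, ∏ i, dft X T (fourierFreq T l i) ω ∂P‖ ≤ C := by
  induction n with
  | zero => exact ⟨0, le_rfl, fun m hm hm1 => by omega⟩
  | succ n ih =>
    obtain ⟨C, hC0, hC⟩ := ih (by omega)
    obtain ⟨K, hK0, hK⟩ := exists_norm_moment_sub_le (n := n + 1) (by omega) C
    have hXn := hX.mono hn
    -- In order one there are no lags and the assumption is vacuous.
    have hAn : AssumptionA P X (n + 1) := by
      rcases Nat.eq_zero_or_pos n with rfl | hpos
      · exact fun j => j.elim0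
      · exact hA _ (by omega) hn
    set B := ∑' v : Fin n → ℤ, |autocumulant P X v| * ∑ j, |(v j : ℝ)| with hB
    have hB0 : 0 ≤ B := tsum_nonneg fun v => by positivity
    refine ⟨C + (K + B), by positivity, fun m hm hm1 T hT l hl => ?_⟩
    rcases Nat.lt_or_ge n m with hlt | hle
    · obtain rfl : m = n + 1 := by omega
      have hl' := (offSubmanifolds_fourierFreq_iff hT l).1 hl
      have h1 := hK (fun b => ∫ ω, ∏ i ∈ b, dft X T (fourierFreq T l i) ω ∂P) fun b hb hbu => by
        rw [integral_prod_dft_finset]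
        have hcard := card_lt_of_ne_univ hbu
        exact hC b.card (by omega) hb.card_pos T hT (fun i => l (b.equivFin.symm i))
          (offSubmanifolds_block b fun s _ => hl s)
      rw [cumOfMoments_dft hXn le_rfl] at h1
      have h2 := norm_sum_cumulant_sub_le hXn hAn T (fourierFreq T l)
      rw [fourierFreq_sum, sum_expNeg_fourier hT (hl' _ Finset.univ_nonempty), zero_mul,
        sub_zero] at h2
      have h3 := norm_le_norm_sub_add (∫ ω, ∏ i, dft X T (fourierFreq T l i) ω ∂P)
        (∑ t ∈ Fintype.piFinset (fun _ : Fin (n + 1) => Finset.Icc 1 T),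
        (cumulant P (fun i => X (t i)) : ℂ) * ∏ i, expNeg (fourierFreq T l i) (t i))
      linarith
    · exact (hC m hle hm1 T hT l hl).trans (by linarith)

lemma periodogram_eq_prod {Ω : Type*} {X : ℤ → Ω → ℝ} (T : ℕ) {k : ℕ} (lam : Fin k → ℝ)
    (ω : Ω) :
    periodogram X T lam ω =
      (T : ℂ)⁻¹ * ∏ i, dft X T ((Fin.cons (-∑ j, lam j) lam : Fin (k + 1) → ℝ) i) ω := by
  rw [periodogram, Fin.prod_univ_succ]
  simp only [Fin.cons_zero, Fin.cons_succ]
  ring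

lemma integrable_periodogram [IsProbabilityMeasure P] {k : ℕ}
    (hX : IsStationaryOfOrder P X (k + 1)) (T : ℕ) (lam : Fin k → ℝ) :
    Integrable (periodogram X T lam) P := by
  have h := (integrable_prod_dft hX (ι := Fin (k + 1)) (by simp) T
    (Fin.cons (-∑ j, lam j) lam)).const_mul (T : ℂ)⁻¹
  exact h.congr (.of_forall fun ω => (periodogram_eq_prod T lam ω).symm)

/-- Appending the negative total to frequencies off the submanifolds, all proper partial sums are
nonzero modulo `2π`. -/
lemma OffSubmanifolds.sum_cons_ne {k : ℕ} {lam : Fin k → ℝ} (h : OffSubmanifolds lam)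
    {s : Finset (Fin (k + 1))} (hs : s.Nonempty) (hsu : s ≠ Finset.univ) (m : ℤ) :
    ∑ i ∈ s, (Fin.cons (-∑ j, lam j) lam : Fin (k + 1) → ℝ) i ≠ 2 * Real.pi * (m : ℝ) := by
  classical
  have key : ∀ u : Finset (Fin (k + 1)), u.Nonempty → 0 ∉ u → ∀ m : ℤ,
      ∑ i ∈ u, (Fin.cons (-∑ j, lam j) lam : Fin (k + 1) → ℝ) i ≠ 2 * Real.pi * (m : ℝ) := by
    intro u hu h0 m
    have hu' : u = (Finset.univ.filter fun j : Fin k => j.succ ∈ u).map (Fin.succEmb k) := by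
      ext i
      refine Fin.cases ?_ (fun j => ?_) i
      · simp [h0]
      · simp
    have hne : (Finset.univ.filter fun j : Fin k => j.succ ∈ u).Nonempty := by
      rw [hu'] at hu
      exact Finset.map_nonempty.1 hu
    rw [hu', Finset.sum_map]
    simpa using h _ hne m
  -- The total is zero, so a set containing the appended frequency has minus the sum of its
  -- complement, which avoids that frequency.
  by_cases h0 : 0 ∈ s
  · intro he
    have htot : ∑ i, (Fin.cons (-∑ j, lam j) lam : Fin (k + 1) → ℝ) i = 0 := by
      rw [Fin.sum_univ_succ]
      simp
    have hc := Finset.sum_add_sum_compl s (Fin.cons (-∑ j, lam j) lam : Fin (k + 1) → ℝ)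
    refine key sᶜ ?_ (by simpa using h0) (-m) ?_
    · rw [Finset.nonempty_iff_ne_empty, Ne, Finset.compl_eq_empty_iff]
      exact hsu
    · push_cast
      linarith
  · exact key s hs h0 m

/-- Off the submanifolds, the periodogram is an unbiased estimator of the polyspectrum
up to `O(1/T)`, uniformly over the Fourier frequencies. -/
lemma exists_norm_integral_periodogram_sub_le [IsProbabilityMeasure P] {k : ℕ} (hk : 1 ≤ k)
    (hX : IsStationaryOfOrder P X (k + 1))
    (hA : ∀ r, 2 ≤ r → r ≤ k + 1 → AssumptionA P X r) :
    ∃ K : ℝ, 0 ≤ K ∧ ∀ T : ℕ, 1 ≤ T → ∀ l : Fin k → ℤ, OffSubmanifolds (fourierFreq T l) →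
      ‖∫ ω, periodogram X T (fourierFreq T l) ω ∂P - polyspectrum P X k (fourierFreq T l)‖ ≤
        K / T := by
  obtain ⟨C, hC0, hC⟩ := exists_norm_integral_prod_dft_le hX hA k (by omega)
  obtain ⟨K, hK0, hK⟩ := exists_norm_moment_sub_le (n := k + 1) (by omega) C
  set B := ∑' v : Fin k → ℤ, |autocumulant P X v| * ∑ j, |(v j : ℝ)| with hB
  have hB0 : 0 ≤ B := tsum_nonneg fun v => by positivity
  refine ⟨K + B, by positivity, fun T hT l hl => ?_⟩
  have hT0 : (T : ℂ) ≠ 0 := by exact_mod_cast (by omega : T ≠ 0)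
  -- The appended frequency takes index 0, the base time of the cumulant, so the polyspectrum is
  -- evaluated at the original `k` frequencies.
  set lam : Fin (k + 1) → ℝ := Fin.cons (-∑ j, fourierFreq T l j) (fourierFreq T l) with hlam
  -- The appended frequency may leave `(-π, π]`, which is harmless: the moment bound holds for
  -- arbitrary integer indices.
  have hfour : lam = fourierFreq T (Fin.cons (-∑ j, l j) l : Fin (k + 1) → ℤ) := by
    funext i
    refine Fin.cases ?_ (fun j => ?_) i
    · rw [hlam, Fin.cons_zero, fourierFreq_sum]
      simp only [fourierFreq, Fin.cons_zero]
      push_cast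
      ring
    · simp [hlam, fourierFreq]
  have h1 := hK (fun b => ∫ ω, ∏ i ∈ b, dft X T (lam i) ω ∂P) fun b hb hbu => by
    rw [integral_prod_dft_finset]
    have hcard := card_lt_of_ne_univ hbu
    have hoff := offSubmanifolds_block (lam := lam) b fun s hsb hs =>
      hl.sum_cons_ne hs fun hsu => hbu (Finset.univ_subset_iff.1 (hsu ▸ hsb))
    rw [hfour] at hoff ⊢
    exact hC b.card (by omega) hb.card_pos T hT _ hoff
  rw [cumOfMoments_dft hX le_rfl] at h1
  have h2 := norm_sum_cumulant_sub_le hX (hA _ (by omega) le_rfl) T lam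
  have htot : ∑ i, lam i = 0 := by
    rw [Fin.sum_univ_succ]
    simp [hlam]
  rw [htot, sum_expNeg_zero] at h2
  have h3 := norm_sub_le_norm_sub_add_norm_sub (∫ ω, ∏ i, dft X T (lam i) ω ∂P)
    (∑ t ∈ Fintype.piFinset (fun _ : Fin (k + 1) => Finset.Icc 1 T),
      (cumulant P (fun i => X (t i)) : ℂ) * ∏ i, expNeg (lam i) (t i))
    (T * polyspectrum P X k (fourierFreq T l))
  have h4 : ∫ ω, periodogram X T (fourierFreq T l) ω ∂P - polyspectrum P X k (fourierFreq T l) =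
      (T : ℂ)⁻¹ * (∫ ω, ∏ i, dft X T (lam i) ω ∂P -
        T * polyspectrum P X k (fourierFreq T l)) := by
    simp only [periodogram_eq_prod]
    rw [integral_const_mul, mul_sub, inv_mul_cancel_left₀ hT0]
  rw [h4, norm_mul, norm_inv, Complex.norm_natCast, inv_mul_eq_div]
  have h5 : (fun j : Fin k => lam j.succ) = fourierFreq T l := by
    funext j
    simp [hlam]
  rw [h5] at h2
  gcongr
  linarith

end Expectation

/-! ### Counting Fourier frequencies. -/

section Grid

lemma mem_fourierIndices {T : ℕ} {l : ℤ} :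
    l ∈ fourierIndices T ↔ -(T : ℤ) < 2 * l ∧ 2 * l ≤ T := by
  simp only [fourierIndices, Finset.mem_filter, Finset.mem_Icc]
  omega

lemma mem_fourierGrid {T k : ℕ} {l : Fin k → ℤ} :
    l ∈ fourierGrid T k ↔ ∀ j, -(T : ℤ) < 2 * l j ∧ 2 * l j ≤ T := by
  simp only [fourierGrid, Fintype.mem_piFinset, mem_fourierIndices]

lemma eq_of_mem_fourierIndices {T : ℕ} {a b : ℤ} (ha : a ∈ fourierIndices T)
    (hb : b ∈ fourierIndices T) (h : (T : ℤ) ∣ a - b) : a = b := by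
  rw [mem_fourierIndices] at ha hb
  have := Int.eq_zero_of_abs_lt_dvd h (by rw [abs_lt]; omega)
  omega

lemma card_fourierIndices_le (T : ℕ) : (fourierIndices T).card ≤ T := by
  have h : fourierIndices T ⊆ Finset.Ioc ((T / 2 : ℕ) - (T : ℤ)) (T / 2 : ℕ) := fun l hl => by
    rw [mem_fourierIndices] at hl
    rw [Finset.mem_Ioc]
    omega
  simpa using Finset.card_le_card h

lemma card_fourierGrid_le (T k : ℕ) : (fourierGrid T k).card ≤ T ^ k := by
  simpa [fourierGrid] using Nat.pow_le_pow_left (card_fourierIndices_le T) k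

/-- The number of grid points on one submanifold. -/
lemma card_filter_dvd_le (T k : ℕ) {s : Finset (Fin k)} (hs : s.Nonempty) :
    ((fourierGrid T k).filter fun l => (T : ℤ) ∣ ∑ i ∈ s, l i).card ≤ T ^ (k - 1) := by
  classical
  obtain ⟨j, hj⟩ := hs
  calc _ ≤ (Fintype.piFinset fun _ : {i : Fin k // i ≠ j} => fourierIndices T).card := by
        -- On the submanifold the coordinate `j ∈ s` is determined modulo `T` by the others, and
        -- Fourier indices are distinct modulo `T`.
        refine Finset.card_le_card_of_injOn (fun l i => l i) ?_ ?_
        · intro l hl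
          simp only [Finset.coe_filter, Set.mem_ofPred_eq, fourierGrid, Fintype.mem_piFinset] at hl
          simpa using fun i _ => hl.1 i
        · intro l hl l' hl' heq
          simp only [Finset.coe_filter, Set.mem_ofPred_eq, fourierGrid,
            Fintype.mem_piFinset] at hl hl'
          have hne : ∀ i, i ≠ j → l i = l' i := fun i hi => congrFun heq ⟨i, hi⟩
          have hsum : ∑ i ∈ s.erase j, l i = ∑ i ∈ s.erase j, l' i :=
            Finset.sum_congr rfl fun i hi => hne i (Finset.ne_of_mem_erase hi)
          have hd := dvd_sub hl.2 hl'.2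
          rw [← Finset.add_sum_erase s l hj, ← Finset.add_sum_erase s l' hj, hsum,
            add_sub_add_right_eq_sub] at hd
          funext i
          by_cases hi : i = j
          · rw [hi]
            exact eq_of_mem_fourierIndices (hl.1 j) (hl'.1 j) hd
          · exact hne i hi
    _ ≤ T ^ (k - 1) := by
        simpa using Nat.pow_le_pow_left (card_fourierIndices_le T) (k - 1)

open Classical in
/-- The number of grid points on the submanifolds. -/
lemma card_filter_not_offSubmanifolds_le {T k : ℕ} (hT : 1 ≤ T) :
    ((fourierGrid T k).filter fun l => ¬ OffSubmanifolds (fourierFreq T l)).card ≤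
      2 ^ k * T ^ (k - 1) := by
  calc _ ≤ ((Finset.univ.filter fun s : Finset (Fin k) => s.Nonempty).biUnion fun s =>
        (fourierGrid T k).filter fun l => (T : ℤ) ∣ ∑ i ∈ s, l i).card := by
        refine Finset.card_le_card fun l hl => ?_
        rw [Finset.mem_filter, offSubmanifolds_fourierFreq_iff hT] at hl
        push Not at hl
        obtain ⟨hl, s, hs, hd⟩ := hl
        simp only [Finset.mem_biUnion, Finset.mem_filter, Finset.mem_univ, true_and]
        exact ⟨s, hs, hl, hd⟩
    _ ≤ (Finset.univ.filter fun s : Finset (Fin k) => s.Nonempty).card * T ^ (k - 1) :=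
        Finset.card_biUnion_le_card_mul _ _ _ fun s hs =>
          card_filter_dvd_le T k (Finset.mem_filter.1 hs).2
    _ ≤ _ := by
        gcongr
        refine (Finset.card_filter_le _ _).trans ?_
        simp

lemma fourierFreq_mem_cubeIoc {T k : ℕ} (hT : 1 ≤ T) {l : Fin k → ℤ}
    (hl : l ∈ fourierGrid T k) : fourierFreq T l ∈ cubeIoc k := by
  rw [mem_fourierGrid] at hl
  have hT0 : (0 : ℝ) < T := by exact_mod_cast hT
  intro j _
  have h1 : -(T : ℝ) < 2 * (l j : ℝ) := by exact_mod_cast (hl j).1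
  have h2 : 2 * (l j : ℝ) ≤ T := by exact_mod_cast (hl j).2
  have hpi := Real.pi_pos
  rw [fourierFreq, Set.mem_Ioc, lt_div_iff₀ hT0, div_le_iff₀ hT0]
  constructor <;> nlinarith

lemma cubeIoc_subset_cube (k : ℕ) : cubeIoc k ⊆ cube k :=
  Set.pi_mono fun _ _ => Set.Ioc_subset_Icc_self

lemma fourierFreq_mem_cube {T k : ℕ} (hT : 1 ≤ T) {l : Fin k → ℤ} (hl : l ∈ fourierGrid T k) :
    fourierFreq T l ∈ cube k :=
  cubeIoc_subset_cube k (fourierFreq_mem_cubeIoc hT hl)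

end Grid

/-! ### Boundedness and Lipschitz continuity of the polyspectrum. -/

section Polyspectrum

variable {Ω : Type*} [MeasurableSpace Ω] {P : Measure Ω} {X : ℤ → Ω → ℝ}

lemma AssumptionA.norm_polyspectrum_le {m : ℕ} (hA : AssumptionA P X (m + 1))
    (lam : Fin m → ℝ) : ‖polyspectrum P X m lam‖ ≤ ∑' v : Fin m → ℤ, |autocumulant P X v| :=
  tsum_of_norm_bounded hA.summable_abs.hasSum fun v => (norm_polyTerm lam v).le

lemma AssumptionA.norm_polyspectrum_sub_le {m : ℕ} (hA : AssumptionA P X (m + 1))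
    (lam mu : Fin m → ℝ) :
    ‖polyspectrum P X m lam - polyspectrum P X m mu‖ ≤
      (∑' v : Fin m → ℤ, |autocumulant P X v| * ∑ j, |(v j : ℝ)|) * dist lam mu := by
  have h : polyspectrum P X m lam - polyspectrum P X m mu =
      ∑' v, (polyTerm P X lam v - polyTerm P X mu v) :=
    ((hA.summable_polyTerm lam).tsum_sub (hA.summable_polyTerm mu)).symm
  rw [h, ← tsum_mul_right]
  refine tsum_of_norm_bounded (hA.summable_mul_sum.mul_right _).hasSum fun v => ?_
  rw [polyTerm, polyTerm, ← mul_sub, norm_mul, Complex.norm_real, Real.norm_eq_abs, mul_assoc]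
  refine mul_le_mul_of_nonneg_left ?_ (abs_nonneg _)
  have hexp : ∀ x y : ℝ, ‖Complex.exp (-Complex.I * (x : ℂ)) - Complex.exp (-Complex.I * (y : ℂ))‖
      ≤ |x - y| := by
    intro x y
    have h1 : Complex.exp (-Complex.I * (x : ℂ)) - Complex.exp (-Complex.I * (y : ℂ)) =
        Complex.exp (-Complex.I * (y : ℂ)) *
          (Complex.exp (Complex.I * ((y - x : ℝ) : ℂ)) - 1) := by
      rw [mul_sub, mul_one, ← Complex.exp_add]
      congr 2
      push_cast
      ring
    have h2 := norm_expNeg y 1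
    rw [expNeg, mul_one] at h2
    rw [h1, norm_mul, h2, one_mul, abs_sub_comm, ← Real.norm_eq_abs]
    exact Real.norm_exp_I_mul_ofReal_sub_one_le
  refine (hexp _ _).trans ?_
  rw [← Finset.sum_sub_distrib, Finset.sum_mul]
  refine (Finset.abs_sum_le_sum_abs _ _).trans (Finset.sum_le_sum fun j _ => ?_)
  rw [← mul_sub, abs_mul, ← Real.dist_eq]
  exact mul_le_mul_of_nonneg_left (dist_le_pi_dist lam mu j) (abs_nonneg _)

end Polyspectrum

/-! ### Riemann sums and the step function `g_T`. -/

section Discretization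

/-- The index of the grid cell of side `2π/T` containing a point. -/
noncomputable def cellIndex (T : ℕ) {k : ℕ} (w : Fin k → ℝ) : Fin k → ℤ :=
  fun j => ⌈w j * T / (2 * Real.pi)⌉ - 1

/-- The grid cell with lower corner `fourierFreq T l`. -/
def cell (T : ℕ) {k : ℕ} (l : Fin k → ℤ) : Set (Fin k → ℝ) :=
  Set.univ.pi fun j => Set.Ioc (fourierFreq T l j) (fourierFreq T l j + 2 * Real.pi / T)

/-- Cells are open at the lower end, so the lower corner is the last grid point strictly below `w`:
hence the ceiling minus one. The cells tile space, and at most one indicator in `g_T` is nonzero. -/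
lemma mem_cell_iff {T k : ℕ} (hT : 1 ≤ T) {l : Fin k → ℤ} {w : Fin k → ℝ} :
    w ∈ cell T l ↔ l = cellIndex T w := by
  have hT0 : (0 : ℝ) < T := by exact_mod_cast hT
  have hpi := Real.two_pi_pos
  rw [cell, Set.mem_univ_pi, funext_iff]
  refine forall_congr' fun j => ?_
  rw [cellIndex, eq_sub_iff_add_eq, eq_comm (b := ⌈_⌉), Int.ceil_eq_iff, Set.mem_Ioc, fourierFreq,
    ← add_div, div_lt_iff₀ hT0, le_div_iff₀ hT0, lt_div_iff₀ hpi, div_le_iff₀ hpi]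
  push_cast
  constructor <;> rintro ⟨h1, h2⟩ <;> constructor <;> linarith

lemma measurableSet_cell (T : ℕ) {k : ℕ} (l : Fin k → ℤ) : MeasurableSet (cell T l) :=
  MeasurableSet.univ_pi fun _ => measurableSet_Ioc

lemma discretization_apply {T k : ℕ} (hT : 1 ≤ T) (g : (Fin k → ℝ) → ℂ) (w : Fin k → ℝ) :
    discretization g T w =
      if cellIndex T w ∈ fourierGrid T k then g (fourierFreq T (cellIndex T w)) else 0 := by
  classical
  have h : ∀ l : Fin k → ℤ, Set.indicator (cell T l) (fun _ => g (fourierFreq T l)) w =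
      if l = cellIndex T w then g (fourierFreq T l) else 0 := fun l => by
    rw [Set.indicator_apply]
    exact if_congr (mem_cell_iff hT) rfl rfl
  change ∑ l ∈ fourierGrid T k, Set.indicator (cell T l) (fun _ => g (fourierFreq T l)) w = _
  simp only [h]
  rw [Finset.sum_ite_eq']

lemma dist_fourierFreq_cellIndex_le {T k : ℕ} (hT : 1 ≤ T) (w : Fin k → ℝ) :
    dist w (fourierFreq T (cellIndex T w)) ≤ 2 * Real.pi / T := by
  have h := (mem_cell_iff hT).2 (rfl : cellIndex T w = cellIndex T w)
  rw [dist_pi_le_iff (by positivity)]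
  intro j
  have hj := h j (Set.mem_univ j)
  rw [Set.mem_Ioc] at hj
  rw [Real.dist_eq, abs_le]
  have : 0 ≤ 2 * Real.pi / T := by positivity
  constructor <;> linarith

lemma norm_discretization_le {T k : ℕ} (hT : 1 ≤ T) {g : (Fin k → ℝ) → ℂ} {C : ℝ}
    (hC0 : 0 ≤ C) (hC : ∀ lam ∈ cube k, ‖g lam‖ ≤ C) (w : Fin k → ℝ) :
    ‖discretization g T w‖ ≤ C := by
  rw [discretization_apply hT]
  split_ifs with h
  · exact hC _ (fourierFreq_mem_cube hT h)
  · simpa using hC0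

lemma volume_real_cell {T k : ℕ} (l : Fin k → ℤ) :
    volume.real (cell T l) = (2 * Real.pi / T) ^ k := by
  rw [measureReal_def, cell, Real.volume_pi_Ioc_toReal]
  · simp [div_pow]
  · intro j
    simp only [le_add_iff_nonneg_right]
    positivity

lemma volume_cell_ne_top (T : ℕ) {k : ℕ} (l : Fin k → ℤ) : volume (cell T l) ≠ ⊤ := by
  rw [cell, Real.volume_pi_Ioc]
  exact ENNReal.prod_ne_top fun _ _ => ENNReal.ofReal_ne_top

lemma integrable_discretization {k : ℕ} (g : (Fin k → ℝ) → ℂ) (T : ℕ) :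
    Integrable (discretization g T) :=
  integrable_finsetSum _ fun l _ =>
    (integrable_indicator_iff (measurableSet_cell T l)).2
      (integrableOn_const (volume_cell_ne_top T l))

lemma integral_discretization {k : ℕ} (g : (Fin k → ℝ) → ℂ) (T : ℕ) :
    ∫ w, discretization g T w =
      (2 * (Real.pi : ℂ)) ^ k * ((T : ℂ) ^ k)⁻¹ * ∑ l ∈ fourierGrid T k, g (fourierFreq T l) := by
  change ∫ w, ∑ l ∈ fourierGrid T k,
    Set.indicator (cell T l) (fun _ => g (fourierFreq T l)) w = _
  rw [integral_finsetSum _ fun l _ => (integrable_indicator_iff (measurableSet_cell T l)).2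
      (integrableOn_const (volume_cell_ne_top T l)), Finset.mul_sum]
  refine Finset.sum_congr rfl fun l _ => ?_
  rw [integral_indicator_const _ (measurableSet_cell T l), volume_real_cell, Complex.real_smul]
  push_cast
  rw [div_pow, div_eq_mul_inv]

/-- Bounds the volume gained by lengthening the sides of the cube by one mesh width, through `(1 +
x)^k - 1 ≤ 2^k x` with `x = 1/T ≤ 1`. -/
lemma add_pow_sub_pow_le {T : ℕ} (hT : 1 ≤ T) (k : ℕ) :
    (2 * Real.pi + 2 * Real.pi / T) ^ k - (2 * Real.pi) ^ k ≤ (4 * Real.pi) ^ k / T := by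
  have hT1 : (1 : ℝ) ≤ T := by exact_mod_cast hT
  have hT0 : (0 : ℝ) < T := by linarith
  have h : ∀ k : ℕ, (1 + 1 / (T : ℝ)) ^ k - 1 ≤ 2 ^ k / T := by
    intro k
    induction k with
    | zero => simp
    | succ k ih =>
      have h1 : (1 + 1 / (T : ℝ)) ^ k ≤ 2 ^ k := by
        gcongr
        have : 1 / (T : ℝ) ≤ 1 := by rw [div_le_one hT0]; exact hT1
        linarith
      have h2 : (1 + 1 / (T : ℝ)) ^ k * (1 / T) ≤ 2 ^ k * (1 / T) := by gcongr
      rw [pow_succ, pow_succ]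
      have h3 : (2 : ℝ) ^ k / T = 2 ^ k * (1 / T) := by ring
      have h4 : (2 : ℝ) ^ k * 2 / T = 2 * (2 ^ k * (1 / T)) := by ring
      linarith
  have h5 : (2 * Real.pi + 2 * Real.pi / T) ^ k - (2 * Real.pi) ^ k =
      (2 * Real.pi) ^ k * ((1 + 1 / (T : ℝ)) ^ k - 1) := by
    rw [mul_sub, ← mul_pow]
    ring
  rw [h5, show (4 * Real.pi) ^ k / T = (2 * Real.pi) ^ k * (2 ^ k / T) by
    rw [← mul_div_assoc, ← mul_pow]; ring]
  exact mul_le_mul_of_nonneg_left (h k) (by positivity)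

lemma measurableSet_cubeIoc (k : ℕ) : MeasurableSet (cubeIoc k) :=
  MeasurableSet.univ_pi fun _ => measurableSet_Ioc

lemma volume_cubeIoc_ne_top (k : ℕ) : volume (cubeIoc k) ≠ ⊤ := by
  rw [cubeIoc, Real.volume_pi_Ioc]
  exact ENNReal.prod_ne_top fun _ _ => ENNReal.ofReal_ne_top

lemma volume_real_cubeIoc (k : ℕ) : volume.real (cubeIoc k) = (2 * Real.pi) ^ k := by
  rw [measureReal_def, cubeIoc, Real.volume_pi_Ioc_toReal]
  · simp [two_mul]
  · intro j
    dsimp only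
    linarith [Real.pi_pos]

/-- The part of the discretization outside the cube is negligible. -/
lemma norm_integral_discretization_sub_le {T k : ℕ} (hT : 1 ≤ T) {g : (Fin k → ℝ) → ℂ} {C : ℝ}
    (hC0 : 0 ≤ C) (hC : ∀ lam ∈ cube k, ‖g lam‖ ≤ C) :
    ‖(∫ w, discretization g T w) - ∫ w in cubeIoc k, discretization g T w‖ ≤
      C * (4 * Real.pi) ^ k / T := by
  have hside : 0 ≤ 2 * Real.pi / T := by positivity
  -- Lower corners lie in `(-π, π]`, so cells can overhang the cube only on the upper side, by at
  -- most one mesh width.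
  set big : Set (Fin k → ℝ) :=
    Set.univ.pi fun _ => Set.Ioc (-Real.pi) (Real.pi + 2 * Real.pi / T) with hbig
  have hbig_vol : volume.real big = (2 * Real.pi + 2 * Real.pi / T) ^ k := by
    rw [measureReal_def, hbig, Real.volume_pi_Ioc_toReal]
    · simp only [Finset.prod_const, Finset.card_univ, Fintype.card_fin]
      ring
    · intro j
      dsimp only
      linarith [Real.pi_pos]
  have hbig_top : volume big ≠ ⊤ := by
    rw [hbig, Real.volume_pi_Ioc]
    exact ENNReal.prod_ne_top fun _ _ => ENNReal.ofReal_ne_top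
  have hsub : cubeIoc k ⊆ big :=
    Set.pi_mono fun _ _ => Set.Ioc_subset_Ioc_right (by linarith)
  have hzero : ∀ w, w ∉ big → discretization g T w = 0 := by
    intro w hw
    rw [discretization_apply hT, if_neg]
    intro hc
    refine hw fun j _ => ?_
    have h1 := fourierFreq_mem_cubeIoc hT hc j (Set.mem_univ j)
    have h2 := (mem_cell_iff hT).2 (rfl : cellIndex T w = cellIndex T w) j (Set.mem_univ j)
    exact ⟨h1.1.trans h2.1, h2.2.trans (by linarith [h1.2])⟩
  rw [← integral_add_compl (measurableSet_cubeIoc k) (integrable_discretization g T),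
    add_sub_cancel_left]
  rw [setIntegral_eq_of_subset_of_forall_sdiff_eq_zero (s := big \ cubeIoc k)
    (measurableSet_cubeIoc k).compl (fun w hw => hw.2)
    (fun w hw => hzero w fun hb => hw.2 ⟨hb, hw.1⟩)]
  refine (norm_setIntegral_le_of_norm_le_const
    ((measure_mono Set.sdiff_subset).trans_lt hbig_top.lt_top)
    fun w _ => norm_discretization_le hT hC0 hC w).trans ?_
  rw [measureReal_sdiff hsub (measurableSet_cubeIoc k) hbig_top, hbig_vol,
    volume_real_cubeIoc, mul_div_assoc C]
  exact mul_le_mul_of_nonneg_left (add_pow_sub_pow_le hT k) hC0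

lemma cubeIoc_ae_eq_cube (k : ℕ) : cubeIoc k =ᵐ[volume] cube k := by
  rw [cubeIoc, cube, Set.pi_univ_Icc]
  exact Measure.univ_pi_Ioc_ae_eq_Icc

/-- Riemann sums of the product of a bounded Lipschitz function and a bounded integrable one. -/
lemma norm_riemannSum_mul_sub_le {T k : ℕ} (hT : 1 ≤ T) {f g : (Fin k → ℝ) → ℂ} {F L C : ℝ}
    (hF : ∀ lam, ‖f lam‖ ≤ F) (hL0 : 0 ≤ L) (hL : ∀ lam mu, ‖f lam - f mu‖ ≤ L * dist lam mu)
    (hC0 : 0 ≤ C) (hC : ∀ lam ∈ cube k, ‖g lam‖ ≤ C) (hg : IntegrableOn g (cube k)) :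
    ‖(2 * (Real.pi : ℂ)) ^ k * ((T : ℂ) ^ k)⁻¹ *
        ∑ l ∈ fourierGrid T k, f (fourierFreq T l) * g (fourierFreq T l) -
      ∫ lam in cube k, f lam * g lam‖ ≤
      F * (∫ w in cubeIoc k, ‖g w - discretization g T w‖) +
        (L * C * (2 * Real.pi) * (2 * Real.pi) ^ k + F * C * (4 * Real.pi) ^ k) / T := by
  have hF0 : 0 ≤ F := (norm_nonneg _).trans (hF 0)
  have hf_cont : Continuous f :=
    (LipschitzWith.of_dist_le_mul (K := ⟨L, hL0⟩) fun x y => by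
      rw [dist_eq_norm]; exact hL x y).continuous
  have hg' : IntegrableOn g (cubeIoc k) := hg.mono_set (cubeIoc_subset_cube k)
  have hfg : IntegrableOn (fun w => f w * g w) (cubeIoc k) :=
    hg'.bdd_mul hf_cont.aestronglyMeasurable (.of_forall hF)
  set h : (Fin k → ℝ) → ℂ := fun w => f w * g w with hh
  have hpt : ∀ w, ‖h w - discretization h T w‖ ≤
      F * ‖g w - discretization g T w‖ + L * (2 * Real.pi / T) * C := by
    intro w
    rw [discretization_apply hT, discretization_apply hT]
    split_ifs with hc
    · set c := fourierFreq T (cellIndex T w) with hcdef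
      -- Splitting this way puts the sup bound of `f` on the error of `g`, and the Lipschitz bound
      -- of `f` on the bounded value `g c`.
      have e : h w - h c = f w * (g w - g c) + (f w - f c) * g c := by simp only [hh]; ring
      rw [e]
      refine (norm_add_le _ _).trans ?_
      rw [norm_mul, norm_mul]
      have h1 := hC c (fourierFreq_mem_cube hT hc)
      have h2 : ‖f w - f c‖ ≤ L * (2 * Real.pi / T) :=
        (hL w c).trans (mul_le_mul_of_nonneg_left (dist_fourierFreq_cellIndex_le hT w) hL0)
      gcongr
      exact hF w
    · simp only [sub_zero, hh, norm_mul]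
      have h1 : ‖f w‖ * ‖g w‖ ≤ F * ‖g w‖ := by gcongr; exact hF w
      have h2 : 0 ≤ L * (2 * Real.pi / T) * C := by positivity
      linarith
  have hCh : ∀ lam ∈ cube k, ‖h lam‖ ≤ F * C := fun lam hlam => by
    simp only [hh, norm_mul]
    exact mul_le_mul (hF lam) (hC lam hlam) (norm_nonneg _) hF0
  have hout := norm_integral_discretization_sub_le hT (mul_nonneg hF0 hC0) hCh
  have hfin : IsFiniteMeasure (volume.restrict (cubeIoc k)) :=
    ⟨by rw [Measure.restrict_apply_univ]; exact (volume_cubeIoc_ne_top k).lt_top⟩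
  have hin : ‖(∫ w in cubeIoc k, discretization h T w) - ∫ w in cubeIoc k, h w‖ ≤
      F * (∫ w in cubeIoc k, ‖g w - discretization g T w‖) +
        L * (2 * Real.pi / T) * C * (2 * Real.pi) ^ k := by
    rw [norm_sub_rev, ← integral_sub hfg (integrable_discretization h T).integrableOn]
    have hint : Integrable (fun w => ‖g w - discretization g T w‖)
        (volume.restrict (cubeIoc k)) :=
      (hg'.sub (integrable_discretization g T).integrableOn).norm
    refine (norm_integral_le_of_norm_le ((hint.const_mul F).add (integrable_const _))
      (.of_forall hpt)).trans_eq ?_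
    simp only [Pi.add_apply]
    rw [integral_add (hint.const_mul F) (integrable_const _), integral_const_mul, integral_const,
      measureReal_restrict_apply_univ, volume_real_cubeIoc, smul_eq_mul, mul_comm (_ ^ k)]
  rw [← integral_discretization h T, ← setIntegral_congr_set (cubeIoc_ae_eq_cube k)]
  refine (norm_sub_le_norm_sub_add_norm_sub _ (∫ w in cubeIoc k, discretization h T w) _).trans ?_
  refine (add_le_add hout hin).trans_eq ?_
  ring

/-- The discretization of a bounded almost everywhere continuous function converges in `L¹`. -/
lemma tendsto_integral_norm_sub_discretization {k : ℕ} {g : (Fin k → ℝ) → ℂ} {C : ℝ}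
    (hC0 : 0 ≤ C) (hC : ∀ lam ∈ cube k, ‖g lam‖ ≤ C) (hg : IntegrableOn g (cube k))
    (hg_cont : ∀ᵐ lam ∂(volume.restrict (cube k)), ContinuousWithinAt g (cube k) lam) :
    Tendsto (fun T : ℕ => ∫ w in cubeIoc k, ‖g w - discretization g T w‖) atTop (nhds 0) := by
  have hfin : IsFiniteMeasure (volume.restrict (cubeIoc k)) :=
    ⟨by rw [Measure.restrict_apply_univ]; exact (volume_cubeIoc_ne_top k).lt_top⟩
  have hg' : IntegrableOn g (cubeIoc k) := hg.mono_set (cubeIoc_subset_cube k)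
  -- Near the faces at `-π` a cell's lower corner may fall outside the grid. At a point of the open
  -- cube this stops once `T` is large, and the faces are null.
  set oo : Set (Fin k → ℝ) := Set.univ.pi fun _ => Set.Ioo (-Real.pi) Real.pi with hoo
  have hoo_eq : oo =ᵐ[volume] cube k := by
    rw [hoo, cube, Set.pi_univ_Icc]
    exact Measure.univ_pi_Ioo_ae_eq_Icc
  have hmem : ∀ᵐ w ∂(volume.restrict (cubeIoc k)), w ∈ oo := by
    rw [Measure.restrict_congr_set ((cubeIoc_ae_eq_cube k).trans hoo_eq.symm)]
    exact ae_restrict_mem (MeasurableSet.univ_pi fun _ => measurableSet_Ioo)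
  have hcont : ∀ᵐ w ∂(volume.restrict (cubeIoc k)), ContinuousWithinAt g (cube k) w := by
    rwa [Measure.restrict_congr_set (cubeIoc_ae_eq_cube k)]
  rw [← integral_zero (Fin k → ℝ) ℝ (μ := volume.restrict (cubeIoc k))]
  refine tendsto_integral_filter_of_dominated_convergence (fun _ => C + C) ?_ ?_
    (integrable_const _) ?_
  · exact .of_forall fun T =>
      (hg'.sub (integrable_discretization g T).integrableOn).norm.aestronglyMeasurable
  · filter_upwards [eventually_ge_atTop 1] with T hT
    filter_upwards [ae_restrict_mem (measurableSet_cubeIoc k)] with w hw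
    rw [norm_norm]
    exact (norm_sub_le _ _).trans (add_le_add (hC w (cubeIoc_subset_cube k hw))
      (norm_discretization_le hT hC0 hC w))
  · filter_upwards [hmem, hcont] with w hw hwc
    have hgrid : ∀ᶠ T : ℕ in atTop, cellIndex T w ∈ fourierGrid T k := by
      -- Every coordinate of `w` is eventually more than a mesh width `2π/T` above `-π`.
      have hev : ∀ᶠ T : ℕ in atTop, ∀ j, 2 * Real.pi < (w j + Real.pi) * T := by
        rw [eventually_all]
        intro j
        have hj := hw j (Set.mem_univ j)
        exact (tendsto_natCast_atTop_atTop.const_mul_atTop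
          (by linarith [hj.1] : 0 < w j + Real.pi)).eventually_gt_atTop _
      filter_upwards [hev, eventually_ge_atTop 1] with T hTw hT
      have hT0 : (0 : ℝ) < T := by exact_mod_cast hT
      have hpi := Real.pi_pos
      rw [mem_fourierGrid]
      intro j
      have hj := hw j (Set.mem_univ j)
      have hc := (mem_cell_iff hT).2 (rfl : cellIndex T w = cellIndex T w) j (Set.mem_univ j)
      simp only [Set.mem_Ioc, fourierFreq, ← add_div, div_lt_iff₀ hT0, le_div_iff₀ hT0] at hc
      have h1 := hTw j
      have h2 : w j * T < Real.pi * T := mul_lt_mul_of_pos_right hj.2 hT0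
      have h3 : -(T : ℝ) < 2 * (cellIndex T w j : ℝ) := by
        by_contra hcon
        push Not at hcon
        nlinarith
      have h4 : 2 * (cellIndex T w j : ℝ) < T := by
        by_contra hcon
        push Not at hcon
        nlinarith
      exact ⟨by exact_mod_cast h3, by exact_mod_cast h4.le⟩
    have hlim : Tendsto (fun T : ℕ => fourierFreq T (cellIndex T w)) atTop
        (nhdsWithin w (cube k)) := by
      refine tendsto_nhdsWithin_iff.2 ⟨?_, ?_⟩
      · rw [tendsto_iff_dist_tendsto_zero]
        refine squeeze_zero' (.of_forall fun _ => dist_nonneg) ?_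
          (tendsto_const_div_atTop_nhds_zero_nat (2 * Real.pi))
        filter_upwards [eventually_ge_atTop 1] with T hT
        rw [dist_comm]
        exact dist_fourierFreq_cellIndex_le hT w
      · filter_upwards [hgrid, eventually_ge_atTop 1] with T h hT
        exact fourierFreq_mem_cube hT h
    have h1 : Tendsto (fun T : ℕ => ‖g w - g (fourierFreq T (cellIndex T w))‖) atTop (nhds 0) := by
      simpa using (tendsto_const_nhds.sub (hwc.tendsto.comp hlim) : Tendsto
        (fun T : ℕ => g w - g (fourierFreq T (cellIndex T w))) atTop (nhds (g w - g w))).norm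
    refine h1.congr' ?_
    filter_upwards [hgrid, eventually_ge_atTop 1] with T h hT
    rw [discretization_apply hT, if_pos h]

end Discretization

/-! ### Expectation of the estimator. -/

section Estimator

variable {Ω : Type*} [MeasurableSpace Ω] {P : Measure Ω} {X : ℤ → Ω → ℝ}

lemma integral_polyMeanEstimator [IsProbabilityMeasure P] {k : ℕ}
    (hX : IsStationaryOfOrder P X (k + 1)) (g : (Fin k → ℝ) → ℂ) (T : ℕ) :
    ∫ ω, polyMeanEstimator X g T ω ∂P =
      (2 * (Real.pi : ℂ)) ^ k * ((T : ℂ) ^ k)⁻¹ * ∑ l ∈ fourierGrid T k,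
        (∫ ω, periodogram X T (fourierFreq T l) ω ∂P) * g (fourierFreq T l) *
          Phi (fourierFreq T l) := by
  simp only [polyMeanEstimator]
  rw [integral_const_mul, integral_finsetSum _ fun l _ =>
    ((integrable_periodogram hX T _).mul_const _).mul_const _]
  simp only [integral_mul_const]

/-- The expected estimator is the Riemann sum of `f_k g` up to `O(1/T)`. -/
lemma exists_norm_integral_polyMeanEstimator_sub_le [IsProbabilityMeasure P] {k : ℕ} (hk : 1 ≤ k)
    (hX : IsStationaryOfOrder P X (k + 1))
    (hA : ∀ r, 2 ≤ r → r ≤ k + 1 → AssumptionA P X r) {g : (Fin k → ℝ) → ℂ} {C : ℝ}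
    (hC0 : 0 ≤ C) (hC : ∀ lam ∈ cube k, ‖g lam‖ ≤ C) :
    ∃ K : ℝ, ∀ T : ℕ, 1 ≤ T →
      ‖∫ ω, polyMeanEstimator X g T ω ∂P - (2 * (Real.pi : ℂ)) ^ k * ((T : ℂ) ^ k)⁻¹ *
        ∑ l ∈ fourierGrid T k, polyspectrum P X k (fourierFreq T l) * g (fourierFreq T l)‖ ≤
      K / T := by
  classical
  obtain ⟨K, hK0, hK⟩ := exists_norm_integral_periodogram_sub_le hk hX hA
  have hF := (hA (k + 1) (by omega) le_rfl).norm_polyspectrum_le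
  set F := ∑' v : Fin k → ℤ, |autocumulant P X v| with hFdef
  have hF0 : 0 ≤ F := tsum_nonneg fun _ => abs_nonneg _
  refine ⟨(2 * Real.pi) ^ k * (K * C + 2 ^ k * (F * C)), fun T hT => ?_⟩
  have hT0 : (0 : ℝ) < T := by exact_mod_cast hT
  rw [integral_polyMeanEstimator hX, ← mul_sub, ← Finset.sum_sub_distrib, norm_mul, norm_mul,
    norm_inv, norm_pow, norm_pow, norm_mul, Complex.norm_real, Real.norm_eq_abs,
    abs_of_pos Real.pi_pos, Complex.norm_natCast, Complex.norm_ofNat]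
  -- Off the submanifolds the error is the periodogram bias; on them `Φ` discards the whole term
  -- `f_k g`, of size at most `F * C`.
  have hterm : ∀ l ∈ fourierGrid T k,
      ‖(∫ ω, periodogram X T (fourierFreq T l) ω ∂P) * g (fourierFreq T l) *
          Phi (fourierFreq T l) - polyspectrum P X k (fourierFreq T l) * g (fourierFreq T l)‖ ≤
        K / T * C + if ¬ OffSubmanifolds (fourierFreq T l) then F * C else 0 := by
    intro l hl
    have hgl := hC _ (fourierFreq_mem_cube hT hl)
    by_cases hoff : OffSubmanifolds (fourierFreq T l)
    · rw [Phi, if_pos hoff, mul_one, ← sub_mul, norm_mul, if_neg (not_not.2 hoff), add_zero]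
      exact mul_le_mul (hK T hT l hoff) hgl (norm_nonneg _) (by positivity)
    · rw [Phi, if_neg hoff, mul_zero, zero_sub, norm_neg, norm_mul, if_pos hoff]
      have h1 := mul_le_mul (hF (fourierFreq T l)) hgl (norm_nonneg _) hF0
      have h2 : 0 ≤ K / T * C := by positivity
      linarith
  have hsum : ‖∑ l ∈ fourierGrid T k,
      ((∫ ω, periodogram X T (fourierFreq T l) ω ∂P) * g (fourierFreq T l) *
          Phi (fourierFreq T l) - polyspectrum P X k (fourierFreq T l) * g (fourierFreq T l))‖ ≤
        (T : ℝ) ^ k * (K / T * C) + 2 ^ k * (T : ℝ) ^ (k - 1) * (F * C) := by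
    refine (norm_sum_le_of_le _ hterm).trans ?_
    rw [Finset.sum_add_distrib, Finset.sum_const, nsmul_eq_mul, ← Finset.sum_filter,
      Finset.sum_const, nsmul_eq_mul]
    have h1 : ((fourierGrid T k).card : ℝ) ≤ (T : ℝ) ^ k := by
      exact_mod_cast card_fourierGrid_le T k
    have h2 : (((fourierGrid T k).filter fun l =>
        ¬ OffSubmanifolds (fourierFreq T l)).card : ℝ) ≤ 2 ^ k * (T : ℝ) ^ (k - 1) := by
      exact_mod_cast card_filter_not_offSubmanifolds_le hT
    gcongr
  -- With `k ≥ 1`, the exceptional count `T^(k-1)` against the normalization `T^k` gives the factor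
  -- `1/T`.
  have hpow : (T : ℝ) ^ k = (T : ℝ) ^ (k - 1) * T := by
    rw [← pow_succ, Nat.sub_add_cancel hk]
  refine (mul_le_mul_of_nonneg_left hsum (by positivity)).trans_eq ?_
  rw [hpow]
  field_simp

end Estimator

end Polyspectral

theorem proposition1 {Ω : Type*} [MeasurableSpace Ω] (P : MeasureTheory.Measure Ω)
    [MeasureTheory.IsProbabilityMeasure P] (X : ℤ → Ω → ℝ) (k : ℕ) (hk : 1 ≤ k)
    (hX : Polyspectral.IsStationaryOfOrder P X (k + 1))
    (hmean : ∀ t, ∫ ω, X t ω ∂P = 0)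
    (hA : ∀ r, 2 ≤ r → r ≤ k + 1 → Polyspectral.AssumptionA P X r)
    (g : (Fin k → ℝ) → ℂ)
    (hg_symm : ∀ lam ∈ Polyspectral.cube k, g lam = (starRingEnd ℂ) (g (-lam)))
    (hg_int : MeasureTheory.IntegrableOn g (Polyspectral.cube k))
    (hg_bdd : ∃ C : ℝ, ∀ lam ∈ Polyspectral.cube k, ‖g lam‖ ≤ C)
    (hg_cont : ∀ᵐ lam ∂(MeasureTheory.volume.restrict (Polyspectral.cube k)),
      ContinuousWithinAt g (Polyspectral.cube k) lam) :
    ((fun T : ℕ => (∫ ω, Polyspectral.polyMeanEstimator X g T ω ∂P) -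
        Polyspectral.polyMean P X g) =o[Filter.atTop] (fun _ : ℕ => (1 : ℝ))) ∧
    (((fun T : ℕ => ∫ w in Polyspectral.cubeIoc k,
          ‖g w - Polyspectral.discretization g T w‖) =O[Filter.atTop]
            (fun T : ℕ => (T : ℝ)⁻¹)) →
      ((fun T : ℕ => (∫ ω, Polyspectral.polyMeanEstimator X g T ω ∂P) -
        Polyspectral.polyMean P X g) =O[Filter.atTop] (fun T : ℕ => (T : ℝ)⁻¹))) := by
  obtain ⟨C', hC'⟩ := hg_bdd
  have hC : ∀ lam ∈ Polyspectral.cube k, ‖g lam‖ ≤ |C'| := fun lam h =>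
    (hC' lam h).trans (le_abs_self _)
  have hC0 := abs_nonneg C'
  obtain ⟨K, hK⟩ := Polyspectral.exists_norm_integral_polyMeanEstimator_sub_le hk hX hA hC0 hC
  have hAk := hA (k + 1) (by omega) le_rfl
  set F := ∑' v : Fin k → ℤ, |Polyspectral.autocumulant P X v|
  set L := ∑' v : Fin k → ℤ, |Polyspectral.autocumulant P X v| * ∑ j, |(v j : ℝ)|
  have hL0 : 0 ≤ L := tsum_nonneg fun v => by positivity
  have hF0 : 0 ≤ F := tsum_nonneg fun _ => abs_nonneg _
  set D := K + (L * |C'| * (2 * Real.pi) * (2 * Real.pi) ^ k + F * |C'| * (4 * Real.pi) ^ k)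
  have hmain : ∀ᶠ T : ℕ in Filter.atTop,
      ‖(∫ ω, Polyspectral.polyMeanEstimator X g T ω ∂P) - Polyspectral.polyMean P X g‖ ≤
        F * (∫ w in Polyspectral.cubeIoc k, ‖g w - Polyspectral.discretization g T w‖) +
          D * (T : ℝ)⁻¹ := by
    filter_upwards [Filter.eventually_ge_atTop 1] with T hT
    refine (norm_sub_le_norm_sub_add_norm_sub _ _ _).trans ((add_le_add (hK T hT)
      (Polyspectral.norm_riemannSum_mul_sub_le hT hAk.norm_polyspectrum_le hL0
        hAk.norm_polyspectrum_sub_le hC0 hC hg_int)).trans_eq ?_)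
    simp only [D, F, L]
    ring
  constructor
  · rw [Asymptotics.isLittleO_one_iff]
    refine squeeze_zero_norm' hmain ?_
    have h1 := (Polyspectral.tendsto_integral_norm_sub_discretization hC0 hC hg_int
      hg_cont).const_mul F
    have h2 := (tendsto_inv_atTop_nhds_zero_nat (𝕜 := ℝ)).const_mul D
    simpa using h1.add h2
  · intro hO
    exact (Asymptotics.IsBigO.of_bound' (hmain.mono fun T h => h.trans (le_abs_self _))).trans
      ((hO.const_mul_left F).add ((Asymptotics.isBigO_refl _ _).const_mul_left D))
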